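/- Let $G$ be a connected commutative algebraic group over $\mathbb C$ with identity $e$, and let $S\subset G$ be a closed irreducible algebraic subvariety with $e\in S$. Let $[S]$ denote the subgroup of $G$ generated by the elements of $S$, and let $\langle S\rangle$ denote the smallest closed algebraic subgroup of $G$ containing $S$. If $S$ is contained in an analytic subgroup $H$ of $G$, that is, a connected immersed, not necessarily closed, complex Lie subgroup of the complex Lie group $G(\mathbb C)$, then $\langle S\rangle=[S]\subset H$. -/

import Mathlib

open CategoryTheory AlgebraicGeometry MonoidalCategory
open scoped MonObj Manifold ContDiff

noncomputable section

namespace ComplexAlgGroup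

/-- The set `X(ℂ)` of complex points of a `ℂ`-scheme `X`, i.e. of morphisms `Spec ℂ ⟶ X` over
`Spec ℂ`. When `X` is a group scheme this is a group (Mathlib's group structure on
`T`-valued points, for `T = Spec ℂ`). -/
abbrev Points (X : Over (Spec (.of ℂ))) : Type :=
  𝟙_ (Over (Spec (.of ℂ))) ⟶ X

variable {X : Over (Spec (.of ℂ))}

/-- The point of the topological space `|X|` underlying a complex point of `X`. -/
def Points.pt (x : Points X) : X.left :=
  x.left (IsLocalRing.closedPoint ℂ)

/-- `S(ℂ)`, the set of complex points lying on a subset `S` of `|X|`. -/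
def complexPoints (S : Set X.left) : Set (Points X) :=
  {x | x.pt ∈ S}

open Classical in
/-- The value `φ(x) ∈ ℂ` at the complex point `x` of a regular function `φ` on the Zariski open
set `U`: the pullback of `φ` along `x : Spec ℂ ⟶ X`, as an element of `Γ(Spec ℂ, ⊤) = ℂ`.
It is given the value `0` if `x` is not in `U`. -/
def evalAt {U : X.left.Opens} (φ : Γ(X.left, U)) (x : Points X) : ℂ :=
  if h : (⊤ : (Spec (.of ℂ)).Opens) ≤ x.left ⁻¹ᵁ U then
    (Scheme.ΓSpecIso (.of ℂ)).hom (Scheme.Hom.appLE x.left U ⊤ h φ)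
  else 0

section Holomorphic

variable {E M : Type*} [NormedAddCommGroup E] [NormedSpace ℂ E]
  [TopologicalSpace M] [ChartedSpace E M]

/-- A map `f : M → X(ℂ)` from a complex manifold `M` is holomorphic (as a map to the
analytification of `X`) if the preimage of every Zariski open `U` is open and, for every
regular function `φ` on `U`, the function `φ ∘ f` is holomorphic on that preimage. This is the
universal property that characterizes the analytification of a complex variety. In particular
such an `f` is continuous for the classical topology of `X(ℂ)`, which is the coarsest one for
which all `U(ℂ)` are open and all `φ : U(ℂ) → ℂ` are continuous. -/
def IsHolomorphic (f : M → Points X) : Prop :=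
  ∀ U : X.left.Opens, IsOpen (f ⁻¹' complexPoints (U : Set X.left)) ∧
    ∀ φ : Γ(X.left, U), MDifferentiableOn 𝓘(ℂ, E) 𝓘(ℂ, ℂ)
      (fun m => evalAt φ (f m)) (f ⁻¹' complexPoints (U : Set X.left))

/-- The differential of the holomorphic map `f : M → X(ℂ)` is injective at every point: a
tangent vector of `M` at `m` that is killed by `d(φ ∘ f)` for all regular functions `φ` defined
near `f m` is zero. (The differentials of these `φ` span the cotangent space of `X` at `f m`.) -/
def HasInjectiveDifferential (f : M → Points X) : Prop :=
  ∀ (m : M) (v : TangentSpace 𝓘(ℂ, E) m),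
    (∀ (U : X.left.Opens), (f m).pt ∈ U → ∀ φ : Γ(X.left, U),
      mfderiv 𝓘(ℂ, E) 𝓘(ℂ, ℂ) (fun m' => evalAt φ (f m')) m v = 0) → v = 0

end Holomorphic

variable {G : Over (Spec (.of ℂ))} [GrpObj G]

/-- A subgroup `H` of `G(ℂ)` is an analytic subgroup if it is a connected immersed complex Lie
subgroup of the complex Lie group `G(ℂ)`: it carries a structure of connected complex Lie group
of some finite dimension `n` (whose topology may be finer than the one induced from `G(ℂ)`, so
that `H` need not be closed) for which the inclusion `H → G(ℂ)` is a holomorphic immersion. -/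
def IsAnalyticSubgroup (H : Subgroup (Points G)) : Prop :=
  ∃ (n : ℕ) (_ : TopologicalSpace H) (_ : ChartedSpace (EuclideanSpace ℂ (Fin n)) H),
    LieGroup 𝓘(ℂ, EuclideanSpace ℂ (Fin n)) ω H ∧
    ConnectedSpace H ∧
    IsHolomorphic (E := EuclideanSpace ℂ (Fin n)) (fun h : H => (h : Points G)) ∧
    HasInjectiveDifferential (E := EuclideanSpace ℂ (Fin n)) (fun h : H => (h : Points G))

/-- A subgroup of `G(ℂ)` is a closed algebraic subgroup if it is Zariski closed, i.e. consists
of the complex points of a Zariski closed subset of `G`. -/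
def IsClosedAlgebraicSubgroup (K : Subgroup (Points G)) : Prop :=
  ∃ Z : Set G.left, IsClosed Z ∧ (K : Set (Points G)) = complexPoints Z

/-- `[S]`: the subgroup of `G(ℂ)` generated by the points of `S`. -/
def generatedSubgroup (S : Set G.left) : Subgroup (Points G) :=
  Subgroup.closure (complexPoints S)

/-- `⟨S⟩`: the smallest closed algebraic subgroup of `G` containing `S`, as the intersection of
all of them. -/
def algebraicHull (S : Set G.left) : Subgroup (Points G) :=
  sInf {K | IsClosedAlgebraicSubgroup K ∧ complexPoints S ⊆ K}

/-- `⟨S⟩` is indeed a closed algebraic subgroup containing `S`, and the smallest one. -/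
theorem isLeast_algebraicHull (S : Set G.left) :
    IsLeast {K : Subgroup (Points G) | IsClosedAlgebraicSubgroup K ∧ complexPoints S ⊆ K}
      (algebraicHull S) := by
  refine ⟨⟨?_, ?_⟩, fun K hK => sInf_le hK⟩
  · refine ⟨⋂₀ {Z : Set G.left | IsClosed Z ∧ ∃ K : Subgroup (Points G),
      complexPoints S ⊆ K ∧ (K : Set (Points G)) = complexPoints Z},
      isClosed_sInter fun Z hZ => hZ.1, ?_⟩
    ext x
    simp only [algebraicHull, SetLike.mem_coe, Subgroup.mem_sInf]
    constructor
    · rintro h Z ⟨hZ, K, hSK, hKZ⟩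
      have hx : x ∈ (K : Set (Points G)) := h K ⟨⟨Z, hZ, hKZ⟩, hSK⟩
      rw [hKZ] at hx
      exact hx
    · rintro h K ⟨⟨Z, hZ, hKZ⟩, hSK⟩
      have hx : x ∈ complexPoints Z := h Z ⟨hZ, K, hSK, hKZ⟩
      rw [← hKZ] at hx
      exact hx
  · intro x hx
    simp only [algebraicHull, SetLike.mem_coe, Subgroup.mem_sInf]
    exact fun K hK => hK.2 hx

end ComplexAlgGroup

end

/-!
The inclusion `[S] ⊆ H` is immediate, since `H` is a subgroup containing `S(ℂ)`. The equality
`⟨S⟩ = [S]` says that the subgroup generated by `S(ℂ)` is Zariski closed, and this is a general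
fact about an irreducible closed subset `S` through the identity, proved with Zariski topology only.

Put `W = S(ℂ) · S(ℂ)⁻¹`, a symmetric set generating `[S]`. As multiplication is continuous in each
variable for the Zariski topology, all powers `W ^ n` are irreducible (`isPreirreducible_pow`). They
increase because `1 ∈ W`, and by Krull's height theorem their closures are eventually constant
(`exists_forall_subset_of_monotone`). Hence some `W ^ n` is dense in the closure `Z` of `[S]`.

By Chevalley's theorem, together with the correspondence between complex points and closed points,
`W ^ n` is the set of complex points of a constructible set (`exists_isConstructible_mul`). A dense
constructible subset of an irreducible space contains a nonempty open set
(`exists_isOpen_inter_subset_of_subset_closure`), so `W ^ n` contains a nonempty open subset `V` of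
`Z`. Each `z ∈ Z` lies in `V · V`, since the nonempty open sets `V` and `z V⁻¹` of the irreducible
space `Z` meet. Thus `Z ⊆ W ^ (2n) ⊆ [S]`, and `[S]` is closed (`isClosed_closure_of_pow`).
-/

open TopologicalSpace Topology
open scoped Pointwise

namespace ComplexAlgGroup

/-! ### Constructible and irreducible sets -/

section Topology

variable {X : Type*} [TopologicalSpace X]

/-- An irreducible set is, generically, either inside or outside a given constructible set. The
statement with both alternatives is stable under Boolean operations. -/
theorem exists_isOpen_inter_subset_or_subset_compl {C F : Set X} (hC : IsConstructible C)
    (hF : IsIrreducible F) :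
    ∃ U, IsOpen U ∧ (F ∩ U).Nonempty ∧ (F ∩ U ⊆ C ∨ F ∩ U ⊆ Cᶜ) := by
  induction hC using IsConstructible.empty_union_induction with
  | open_retrocompact U hU _ =>
    by_cases h : (F ∩ U).Nonempty
    · exact ⟨U, hU, h, .inl Set.inter_subset_right⟩
    · refine ⟨Set.univ, isOpen_univ, by simpa using hF.nonempty, .inr fun x hx hxU => h ⟨x, ?_⟩⟩
      exact ⟨hx.1, hxU⟩
  | union s hs t ht ihs iht =>
    obtain ⟨U, hU, hUF, hUs⟩ := ihs
    obtain ⟨V, hV, hVF, hVt⟩ := iht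
    rcases hUs with hUs | hUs
    · exact ⟨U, hU, hUF, .inl (hUs.trans Set.subset_union_left)⟩
    rcases hVt with hVt | hVt
    · exact ⟨V, hV, hVF, .inl (hVt.trans Set.subset_union_right)⟩
    refine ⟨U ∩ V, hU.inter hV, hF.isPreirreducible U V hU hV hUF hVF, .inr ?_⟩
    rintro x ⟨hxF, hxU, hxV⟩ (hx | hx)
    · exact hUs ⟨hxF, hxU⟩ hx
    · exact hVt ⟨hxF, hxV⟩ hx
  | compl s hs ih =>
    obtain ⟨U, hU, hUF, h⟩ := ih
    exact ⟨U, hU, hUF, by rwa [compl_compl, or_comm]⟩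

/-- A constructible set that is dense in an irreducible set `F` contains a nonempty relatively
open subset of `F`. -/
theorem exists_isOpen_inter_subset_of_subset_closure {C F : Set X} (hC : IsConstructible C)
    (hF : IsIrreducible F) (hFC : F ⊆ closure (C ∩ F)) :
    ∃ U, IsOpen U ∧ (F ∩ U).Nonempty ∧ F ∩ U ⊆ C := by
  obtain ⟨U, hU, ⟨x, hxF, hxU⟩, h | h⟩ := exists_isOpen_inter_subset_or_subset_compl hC hF
  · exact ⟨U, hU, ⟨x, hxF, hxU⟩, h⟩
  · obtain ⟨y, hyU, hyC, hyF⟩ := mem_closure_iff.mp (hFC hxF) U hU hxU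
    exact absurd hyC (h ⟨hyF, hyU⟩)

theorem nonempty_constructible_inter_isClosed_inter_closedPoints [JacobsonSpace X] {C Z : Set X}
    (hC : IsConstructible C) (hZ : IsClosed Z) (h : (C ∩ Z).Nonempty) :
    (C ∩ Z ∩ closedPoints X).Nonempty := by
  obtain ⟨x, hxC, hxZ⟩ := h
  -- Near `x`, the constructible set `C` contains all specializations of `x`.
  obtain ⟨U, hU, hxU, hUC⟩ := exists_isOpen_inter_subset_of_subset_closure hC
    (F := closure {x}) isIrreducible_singleton.closure
    (closure_mono (Set.singleton_subset_iff.mpr ⟨hxC, subset_closure rfl⟩))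
  obtain ⟨y, ⟨hyx, hyU⟩, hy⟩ := nonempty_inter_closedPoints hxU
    (isClosed_closure.isLocallyClosed.inter hU.isLocallyClosed)
  exact ⟨y, ⟨hUC ⟨hyx, hyU⟩,
    hZ.closure_subset_iff.mpr (Set.singleton_subset_iff.mpr hxZ) hyx⟩, hy⟩

theorem isPreirreducible_of_isInducing {Y : Type*} [TopologicalSpace Y] {f : X → Y}
    (hf : IsInducing f) {A : Set X} (hA : IsPreirreducible (f '' A)) : IsPreirreducible A := by
  rintro U V hU hV ⟨x, hxA, hxU⟩ ⟨y, hyA, hyV⟩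
  obtain ⟨U', hU', rfl⟩ := hf.isOpen_iff.mp hU
  obtain ⟨V', hV', rfl⟩ := hf.isOpen_iff.mp hV
  obtain ⟨_, ⟨z, hz, rfl⟩, hzU, hzV⟩ :=
    hA U' V' hU' hV' ⟨f x, ⟨x, hxA, rfl⟩, hxU⟩ ⟨f y, ⟨y, hyA, rfl⟩, hyV⟩
  exact ⟨z, hz, hzU, hzV⟩

end Topology

/-! ### Irreducible sets in groups with separately continuous multiplication -/

section SemitopologicalGroup

variable {P : Type*} [Group P] [TopologicalSpace P] [SeparatelyContinuousMul P]

theorem isPreirreducible_mul {A B : Set P} (hA : IsPreirreducible A) (hB : IsPreirreducible B) :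
    IsPreirreducible (A * B) := by
  rintro U V hU hV ⟨_, ⟨a, ha, b, hb, rfl⟩, hU'⟩ ⟨_, ⟨c, hc, d, hd, rfl⟩, hV'⟩
  obtain ⟨x, hx, hxU, hxV⟩ := hA _ _ (hU.preimage (continuous_mul_const b))
    (hV.preimage (continuous_mul_const d)) ⟨a, ha, hU'⟩ ⟨c, hc, hV'⟩
  obtain ⟨y, hy, hyU, hyV⟩ := hB _ _ (hU.preimage (continuous_const_mul x))
    (hV.preimage (continuous_const_mul x)) ⟨b, hb, hxU⟩ ⟨d, hd, hxV⟩
  exact ⟨x * y, Set.mul_mem_mul hx hy, hyU, hyV⟩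

theorem isPreirreducible_pow {A : Set P} (hA : IsPreirreducible A) :
    ∀ n : ℕ, IsPreirreducible (A ^ n)
  | 0 => by rw [pow_zero]; exact isPreirreducible_singleton
  | n + 1 => by
    rw [pow_succ]
    exact isPreirreducible_mul (isPreirreducible_pow hA n) hA

variable [ContinuousInv P]

/-- In an irreducible subgroup `Z`, every element is a product of two elements of a given nonempty
open subset `Z ∩ U`, because `Z ∩ U` meets `z (Z ∩ U)⁻¹`. -/
theorem exists_mul_eq_of_isPreirreducible {Z : Subgroup P}
    (hZ : IsPreirreducible (Z : Set P)) {U : Set P} (hU : IsOpen U)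
    (hne : ((Z : Set P) ∩ U).Nonempty) {z : P} (hz : z ∈ Z) :
    ∃ a ∈ (Z : Set P) ∩ U, ∃ b ∈ (Z : Set P) ∩ U, a * b = z := by
  obtain ⟨u, huZ, huU⟩ := hne
  obtain ⟨x, hxZ, hxU, hx⟩ := hZ U ((fun y => z * y⁻¹) ⁻¹' U) hU
    (hU.preimage ((continuous_const_mul z).comp continuous_inv)) ⟨u, huZ, huU⟩
    ⟨u⁻¹ * z, mul_mem (inv_mem huZ) hz, by simpa using huU⟩
  exact ⟨z * x⁻¹, ⟨mul_mem hz (inv_mem hxZ), hx⟩, x, ⟨hxZ, hxU⟩, by simp⟩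

/-- The closure of a subgroup. `Subgroup.topologicalClosure` requires multiplication to be
jointly continuous, which in general fails for the Zariski topology. -/
def closureSubgroup (K : Subgroup P) : Subgroup P where
  __ := K.toSubmonoid.topologicalClosure
  inv_mem' hx := map_mem_closure continuous_inv hx fun _ hw => K.inv_mem hw

/-- Let `W` be symmetric and irreducible. If some power `W ^ n` is dense in the subgroup generated
by `W` and contains a nonempty relatively open subset of its own closure, then this subgroup is
closed. -/
theorem isClosed_closure_of_pow {W : Set P} (hW : W⁻¹ = W) (hirr : IsPreirreducible W) (n : ℕ)
    (hmax : ∀ m, W ^ m ⊆ closure (W ^ n)) {U : Set P} (hU : IsOpen U)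
    (hne : (closure (W ^ n) ∩ U).Nonempty) (hUW : closure (W ^ n) ∩ U ⊆ W ^ n) :
    IsClosed (Subgroup.closure W : Set P) := by
  have hpow : ∀ m, W ^ m ⊆ (Subgroup.closure W : Set P) := by
    intro m
    induction m with
    | zero =>
      rw [pow_zero]
      exact Set.singleton_subset_iff.mpr (one_mem _)
    | succ m ih =>
      rw [pow_succ]
      rintro _ ⟨a, ha, b, hb, rfl⟩
      exact mul_mem (ih ha) (Subgroup.subset_closure hb)
  have hle : (Subgroup.closure W : Set P) ⊆ closure (W ^ n) := by
    intro x hx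
    suffices h : ∃ m, x ∈ W ^ m from hmax _ h.choose_spec
    induction hx using Subgroup.closure_induction with
    | mem x hx => exact ⟨1, by rwa [pow_one]⟩
    | one => exact ⟨0, by rw [pow_zero]; rfl⟩
    | mul x y _ _ hx hy =>
      obtain ⟨k, hk⟩ := hx
      obtain ⟨l, hl⟩ := hy
      exact ⟨k + l, by rw [pow_add]; exact Set.mul_mem_mul hk hl⟩
    | inv x _ hx =>
      obtain ⟨k, hk⟩ := hx
      exact ⟨k, by rwa [← hW, inv_pow, Set.inv_mem_inv]⟩
  have hcl : closure (W ^ n) = (closureSubgroup (Subgroup.closure W) : Set P) :=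
    (closure_mono (hpow n)).antisymm (closure_minimal hle isClosed_closure)
  have hZ := (isPreirreducible_pow hirr n).closure
  rw [hcl] at hne hUW hZ
  have heq : closureSubgroup (Subgroup.closure W) ≤ Subgroup.closure W := by
    intro z hz
    obtain ⟨a, ha, b, hb, rfl⟩ := exists_mul_eq_of_isPreirreducible hZ hU hne hz
    exact mul_mem (hpow n (hUW ha)) (hpow n (hUW hb))
  exact closure_subset_iff_isClosed.mp heq

end SemitopologicalGroup

/-! ### Chains of irreducible closed sets -/

section Chains

/-- By Krull's height theorem, an increasing sequence of irreducible closed subsets of the spectrum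
of a Noetherian ring is eventually constant. -/
theorem exists_forall_subset_of_monotone_primeSpectrum {R : Type*} [CommRing R] [IsNoetherianRing R]
    {F : ℕ → Set (PrimeSpectrum R)} (hmono : Monotone F) (hcl : ∀ n, IsClosed (F n))
    (hirr : ∀ n, IsIrreducible (F n)) : ∃ n, ∀ m, F m ⊆ F n := by
  let I : ℕ → Ideal R := fun n => PrimeSpectrum.vanishingIdeal (F n)
  have hI : ∀ n, (I n).IsPrime := fun n =>
    PrimeSpectrum.isIrreducible_iff_vanishingIdeal_isPrime.mp (hirr n)
  -- The heights of the decreasing primes `I n` attain their minimum.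
  let n := Function.argmin fun n => (I n).height
  have hn : ∀ m, (I n).height ≤ (I m).height := fun m =>
    Function.argmin_le (fun n => (I n).height) m
  refine ⟨n, fun m => ?_⟩
  refine (hmono (le_max_left m n)).trans ?_
  have hle : I (max m n) ≤ I n :=
    PrimeSpectrum.vanishingIdeal_anti_mono (hmono (le_max_right m n))
  have heq : I n ≤ I (max m n) := by
    by_contra hlt
    have := hI (max m n)
    have := hI n
    exact (hn (max m n)).not_gt
      (Ideal.height_strict_mono_of_isPrime_of_isPrime (lt_of_le_not_ge hle hlt))
  exact (PrimeSpectrum.vanishingIdeal_anti_mono_iff (hcl n)).mpr heq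

/-- An increasing sequence of irreducible closed subsets of a locally Noetherian scheme through a
fixed point `e` is eventually constant: each member is determined by its trace on an affine open
neighbourhood of `e`. -/
theorem exists_forall_subset_of_monotone {X : Scheme} [IsLocallyNoetherian X] (e : X)
    {F : ℕ → Set X} (hmono : Monotone F) (hcl : ∀ n, IsClosed (F n))
    (hirr : ∀ n, IsIrreducible (F n)) (he : ∀ n, e ∈ F n) : ∃ n, ∀ m, F m ⊆ F n := by
  obtain ⟨R, f, _, y, rfl⟩ := Scheme.exists_Spec_apply_eq e
  have : IsNoetherianRing R := isLocallyNoetherian_Spec.mp (isLocallyNoetherian_of_isOpenImmersion f)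
  have hf : IsOpenEmbedding f := f.isOpenEmbedding
  obtain ⟨n, hn⟩ := exists_forall_subset_of_monotone_primeSpectrum
    (R := R) (F := fun n => f ⁻¹' F n)
    (fun a b hab => Set.preimage_mono (hmono hab)) (fun n => (hcl n).preimage f.continuous)
    (fun n => ⟨⟨y, he n⟩, (hirr n).isPreirreducible.preimage hf⟩)
  refine ⟨n, fun m => ?_⟩
  refine (subset_closure_inter_of_isPreirreducible_of_isOpen (hirr m).isPreirreducible
    hf.isOpen_range ⟨f y, he m, y, rfl⟩).trans (closure_minimal ?_ (hcl n))
  rintro _ ⟨hx, z, rfl⟩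
  exact hn m hx

end Chains

/-! ### Complex points and the Zariski topology -/

section Points

variable {X Y : Over (Spec (.of ℂ))}

theorem pt_comp (x : Points X) (f : X ⟶ Y) : Points.pt (x ≫ f) = f.left x.pt := by
  rfl

theorem isClosed_singleton_pt [LocallyOfFiniteType X.hom] (x : Points X) : IsClosed {x.pt} :=
  (pointEquivClosedPoint X.hom ⟨x.left, Over.w x⟩).2

theorem pt_injective [LocallyOfFiniteType X.hom] :
    Function.Injective (Points.pt : Points X → X.left) := fun x y h =>
  Over.OverMorphism.ext (ext_of_apply_closedPoint_eq X.hom (Over.w x) (Over.w y) h)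

theorem exists_pt_eq [LocallyOfFiniteType X.hom] {p : X.left} (hp : IsClosed {p}) :
    ∃ x : Points X, x.pt = p :=
  ⟨Over.homMk (pointOfClosedPoint X.hom p hp) (pointOfClosedPoint_comp _ _ _),
    pointOfClosedPoint_apply _ _ _ _⟩

theorem image_pt_complexPoints [LocallyOfFiniteType X.hom] (S : Set X.left) :
    Points.pt '' complexPoints S = S ∩ closedPoints X.left := by
  ext p
  constructor
  · rintro ⟨x, hx, rfl⟩
    exact ⟨hx, isClosed_singleton_pt x⟩
  · rintro ⟨hpS, hp⟩
    obtain ⟨x, rfl⟩ := exists_pt_eq hp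
    exact ⟨x, hpS, rfl⟩

theorem jacobsonSpace_left [LocallyOfFiniteType X.hom] : JacobsonSpace X.left :=
  LocallyOfFiniteType.jacobsonSpace (Y := Spec (.of ℂ)) X.hom

theorem isLocallyNoetherian_left [LocallyOfFiniteType X.hom] : IsLocallyNoetherian X.left :=
  LocallyOfFiniteType.isLocallyNoetherian (Y := Spec (.of ℂ)) X.hom

theorem isNoetherian_left [LocallyOfFiniteType X.hom] [QuasiCompact X.hom] :
    IsNoetherian X.left where
  __ := isLocallyNoetherian_left (X := X)
  __ := (quasiCompact_iff_compactSpace (f := X.hom)).mp inferInstance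

/-- A complex point in the image of a constructible set lifts to a complex point of that set, as
the fibre over it contains a closed point. -/
theorem complexPoints_image [LocallyOfFiniteType X.hom] [LocallyOfFiniteType Y.hom] (f : X ⟶ Y)
    {C : Set X.left} (hC : IsConstructible C) :
    complexPoints (f.left '' C) = (fun x : Points X => x ≫ f) '' complexPoints C := by
  have := jacobsonSpace_left (X := X)
  ext y
  constructor
  · rintro ⟨p, hpC, hp⟩
    obtain ⟨q, ⟨hqC, hq⟩, hqc⟩ := nonempty_constructible_inter_isClosed_inter_closedPoints hC
      ((isClosed_singleton_pt y).preimage f.left.continuous) ⟨p, hpC, hp⟩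
    obtain ⟨x, rfl⟩ := exists_pt_eq hqc
    exact ⟨x, hqC, pt_injective ((pt_comp x f).trans hq)⟩
  · rintro ⟨x, hx, rfl⟩
    exact ⟨x.pt, hx, (pt_comp x f).symm⟩

/-- The Zariski topology on the set of complex points. -/
noncomputable instance zariskiTopology : TopologicalSpace (Points X) := .induced Points.pt inferInstance

theorem isInducing_pt : IsInducing (Points.pt : Points X → X.left) := ⟨rfl⟩

theorem continuous_comp_right (f : X ⟶ Y) : Continuous fun x : Points X => (x ≫ f : Points Y) := by
  refine isInducing_pt.continuous_iff.mpr ?_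
  have : Points.pt ∘ (fun x : Points X => (x ≫ f : Points Y)) = f.left ∘ Points.pt :=
    funext fun x => pt_comp x f
  rw [this]
  exact f.left.continuous.comp isInducing_pt.continuous

theorem isPreirreducible_complexPoints [LocallyOfFiniteType X.hom] {S : Set X.left}
    (hS : IsClosed S) (hirr : IsPreirreducible S) : IsPreirreducible (complexPoints S) := by
  have := jacobsonSpace_left (X := X)
  refine isPreirreducible_of_isInducing isInducing_pt ?_
  rw [image_pt_complexPoints, ← isPreirreducible_iff_closure,
    closure_inter_closedPoints hS]
  exact hirr

end Points

/-! ### Products of constructible sets in a group scheme -/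

section Group

open CartesianMonoidalCategory MonObj

variable {G : Over (Spec (.of ℂ))} [GrpObj G]

/-- Translations are induced by endomorphisms of the scheme `G`, such as `x ↦ g * x`. -/
instance : SeparatelyContinuousMul (Points G) where
  continuous_const_mul := fun {g} => by
    convert! continuous_comp_right (toUnit G ≫ g * 𝟙 G) using 2 with x
    rw [MonObj.comp_mul, Category.comp_id, ← Category.assoc,
      toUnit_unique (x ≫ toUnit G) (𝟙 _), Category.id_comp]
  continuous_mul_const := fun {g} => by
    convert! continuous_comp_right (𝟙 G * toUnit G ≫ g) using 2 with x
    rw [MonObj.comp_mul, Category.comp_id, ← Category.assoc,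
      toUnit_unique (x ≫ toUnit G) (𝟙 _), Category.id_comp]

instance : ContinuousInv (Points G) where
  continuous_inv := continuous_comp_right ι[G]

variable [LocallyOfFiniteType G.hom] [QuasiCompact G.hom]


instance : LocallyOfFiniteType (G ⊗ G).hom := by
  dsimp; infer_instance

instance : QuasiCompact (G ⊗ G).hom := by
  dsimp; infer_instance

/-- Chevalley's theorem, applied to the multiplication morphism. -/
theorem exists_isConstructible_mul {A B : Set G.left} (hA : IsConstructible A)
    (hB : IsConstructible B) :
    ∃ C : Set G.left, IsConstructible C ∧
      complexPoints C = complexPoints A * complexPoints B := by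
  have := isNoetherian_left (X := G)
  have : LocallyOfFiniteType (μ[G].left ≫ G.hom) := by rw [Over.w]; infer_instance
  have : LocallyOfFiniteType μ[G].left := locallyOfFiniteType_of_comp _ G.hom
  have : QuasiCompact (μ[G].left ≫ G.hom) := by rw [Over.w]; infer_instance
  have : IsNoetherian (G ⊗ G).left := isNoetherian_left
  have hD := ((fst G G).left.isConstructible_preimage hA).inter
    ((snd G G).left.isConstructible_preimage hB)
  refine ⟨_, μ[G].left.isConstructible_image hD, ?_⟩
  rw [complexPoints_image _ hD]
  ext z
  constructor
  · rintro ⟨x, ⟨hxA, hxB⟩, rfl⟩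
    refine ⟨x ≫ fst G G, ?_, x ≫ snd G G, ?_, ?_⟩
    · simpa [complexPoints, pt_comp] using hxA
    · simpa [complexPoints, pt_comp] using hxB
    · simp [Hom.mul_def, ← comp_lift]
  · rintro ⟨a, ha, b, hb, rfl⟩
    refine ⟨lift a b, ⟨?_, ?_⟩, rfl⟩
    · change (fst G G).left _ ∈ A
      rw [← pt_comp, lift_fst]
      exact ha
    · change (snd G G).left _ ∈ B
      rw [← pt_comp, lift_snd]
      exact hb

end Group

/-! ### The subgroup generated by an irreducible closed set -/

section GeneratedSubgroup

variable {G : Over (Spec (.of ℂ))} [GrpObj G]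

theorem isClosedAlgebraicSubgroup_of_isClosed {K : Subgroup (Points G)}
    (hK : IsClosed (K : Set (Points G))) : IsClosedAlgebraicSubgroup K := by
  obtain ⟨Z, hZ, hZK⟩ := isInducing_pt.isClosed_iff.mp hK
  exact ⟨Z, hZ, hZK.symm⟩

variable [LocallyOfFiniteType G.hom] [QuasiCompact G.hom]

/-- The subgroup generated by an irreducible closed subset through the identity is closed. -/
theorem isClosed_generatedSubgroup {S : Set G.left} (hS : IsClosed S) (hirr : IsIrreducible S)
    (hone : (1 : Points G) ∈ complexPoints S) :
    IsClosed (generatedSubgroup S : Set (Points G)) := by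
  have := isNoetherian_left (X := G)
  have constr : ∀ {Z : Set G.left}, IsClosed Z → IsConstructible Z := fun {Z} hZ =>
    ((NoetherianSpace.isCompact Zᶜ).isConstructible hZ.isOpen_compl).of_compl
  let T : Set (Points G) := complexPoints S
  let W : Set (Points G) := T * T⁻¹
  -- `T` need not be symmetric; `W` is, and it generates the same subgroup.
  have hTW : T ⊆ W := fun x hx => ⟨x, hx, 1, by simpa [T] using hone, mul_one x⟩
  have honeW : (1 : Points G) ∈ W := hTW hone
  have hgen : generatedSubgroup S = Subgroup.closure W := by
    refine le_antisymm (Subgroup.closure_mono hTW) ((Subgroup.closure_le _).mpr ?_)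
    rintro _ ⟨a, ha, b, hb, rfl⟩
    exact mul_mem (Subgroup.subset_closure ha)
      ((inv_mem_iff (H := Subgroup.closure T)).mp (Subgroup.subset_closure hb))
  have hWinv : W⁻¹ = W := by simp [W, mul_inv_rev]
  have hT : IsPreirreducible T := isPreirreducible_complexPoints hS hirr.isPreirreducible
  have hTinv : IsPreirreducible T⁻¹ := by
    rw [← Set.image_inv_eq_inv]
    exact hT.image _ continuous_inv.continuousOn
  have hW : IsPreirreducible W := isPreirreducible_mul hT hTinv
  have hWconstr : ∃ C : Set G.left, IsConstructible C ∧ complexPoints C = W := by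
    have hinv : T⁻¹ = complexPoints (ι[G].left ⁻¹' S) := by
      ext x
      change Points.pt (x ≫ ι[G]) ∈ S ↔ ι[G].left x.pt ∈ S
      rw [pt_comp]
    simp only [W, hinv]
    exact exists_isConstructible_mul (constr hS) (constr (hS.preimage ι[G].left.continuous))
  have hpow : ∀ n : ℕ, ∃ C : Set G.left, IsConstructible C ∧ complexPoints C = W ^ (n + 1) := by
    intro n
    induction n with
    | zero => simpa using hWconstr
    | succ n ih =>
      obtain ⟨C, hC, hCW⟩ := ih
      obtain ⟨D, hD, hDW⟩ := hWconstr
      rw [pow_succ, ← hCW, ← hDW]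
      exact exists_isConstructible_mul hC hD
  -- Exponents are shifted by one since `{1} = W ^ 0` is not covered by `hpow`.
  let F : ℕ → Set G.left := fun n => closure (Points.pt '' (W ^ (n + 1)))
  have hmono : ∀ {m n : ℕ}, m ≤ n → W ^ m ⊆ W ^ n := Set.pow_subset_pow_right honeW
  have hF : ∀ n, IsIrreducible (F n) := fun n =>
    IsIrreducible.closure ⟨⟨_, 1, Set.one_mem_pow honeW, rfl⟩,
      (isPreirreducible_pow hW _).image _ isInducing_pt.continuous.continuousOn⟩
  obtain ⟨n, hn⟩ := exists_forall_subset_of_monotone (Points.pt (1 : Points G)) (F := F)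
    (fun a b hab => closure_mono (Set.image_mono (hmono (Nat.succ_le_succ hab))))
    (fun _ => isClosed_closure) hF (fun _ => subset_closure ⟨1, Set.one_mem_pow honeW, rfl⟩)
  have hcl : closure (W ^ (n + 1)) = Points.pt ⁻¹' F n :=
    isInducing_pt.closure_eq_preimage_closure_image _
  obtain ⟨C, hC, hCW⟩ := hpow n
  obtain ⟨U, hU, ⟨p, hpF, hpU⟩, hUC⟩ := exists_isOpen_inter_subset_of_subset_closure hC (hF n) (by
    refine closure_mono (Set.subset_inter ?_ subset_closure)
    rw [← hCW]
    exact Set.image_subset_iff.mpr fun x hx => hx)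
  rw [hgen]
  refine isClosed_closure_of_pow hWinv hW (n + 1) (fun m x hx => ?_)
    (hU.preimage isInducing_pt.continuous) ?_ ?_
  · rw [hcl]
    exact hn m (subset_closure ⟨x, hmono m.le_succ hx, rfl⟩)
  · obtain ⟨_, hxU, x, hx, rfl⟩ := mem_closure_iff.mp hpF U hU hpU
    exact ⟨x, subset_closure hx, hxU⟩
  · rw [hcl]
    rintro x hx
    rw [← hCW]
    exact hUC hx

end GeneratedSubgroup

end ComplexAlgGroup

theorem proposition2p2
    (G : Over (Spec (.of ℂ))) [GrpObj G] [IsCommMonObj G]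
    [LocallyOfFiniteType G.hom] [QuasiCompact G.hom] [ConnectedSpace G.left]
    (S : Set G.left) (hS_closed : IsClosed S) (hS_irred : IsIrreducible S)
    (hS_one : (1 : ComplexAlgGroup.Points G) ∈ ComplexAlgGroup.complexPoints S)
    (H : Subgroup (ComplexAlgGroup.Points G)) (hH : ComplexAlgGroup.IsAnalyticSubgroup H)
    (hSH : ComplexAlgGroup.complexPoints S ⊆ (H : Set (ComplexAlgGroup.Points G))) :
    ComplexAlgGroup.algebraicHull S = ComplexAlgGroup.generatedSubgroup S ∧
      ComplexAlgGroup.generatedSubgroup S ≤ H := by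
  refine ⟨le_antisymm (sInf_le ⟨?_, Subgroup.subset_closure⟩)
    ((Subgroup.closure_le _).mpr (ComplexAlgGroup.isLeast_algebraicHull S).1.2),
    (Subgroup.closure_le _).mpr hSH⟩
  exact ComplexAlgGroup.isClosedAlgebraicSubgroup_of_isClosed
    (ComplexAlgGroup.isClosed_generatedSubgroup hS_closed hS_irred hS_one)
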